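/- Let $\nu=(p_k)_{k\ge 0}$ be a probability distribution on $\mathbb N_0$ with probability generating function $g(x)=\sum_{k\ge 0}p_k x^k$, and let $T$ be the (finite or infinite) Galton–Watson tree, with root $\mathbf 0$, in which the numbers of children of the individuals are independent with distribution $\nu$. On a realization of $T$, which both players know from the start, Maker and Breaker alternately pick one of the edges of $T$ not picked so far; Maker fixates the edge he picks, Breaker removes the edge he picks. Breaker wins if at some point of the game $\mathbf 0$ lies in a finite component of the graph obtained from $T$ by deleting the removed edges (in particular if $T$ is finite); otherwise Maker wins. Let $p$ be the probability that $T$ is such that Breaker has a winning strategy when Breaker moves first, and $\bar p$ the probability that $T$ is such that Breaker has a winning strategy when Maker moves first. Then both events are measurable, $$p=g(p)+(1-p)\,g'(p)\qquad\text{and}\qquad \bar p=g(p).$$ Here $g$ is differentiable at $p$ if $p<1$; if $p=1$, the term $(1-p)\,g'(p)$ is read as $0$ (also when $g'(1)=\infty$). -/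

import Mathlib

open MeasureTheory ProbabilityTheory

namespace MakerBreaker

/-- The two players. -/
inductive Player
  | maker
  | breaker

/-- The opponent of a player. -/
def Player.other : Player → Player
  | .maker => .breaker
  | .breaker => .maker

variable {V : Type*}

/-- The moves made so far in the (1,1)-game on the edges of a graph, most recent move first. The
players alternate, so the moves and the player who started determine who picked which edge. -/
abbrev History (V : Type*) : Type _ := List (Sym2 V)

/-- The player whose turn it is after the moves `h`. -/
def toMove (first : Player) : History V → Player
  | [] => first
  | _ :: h => (toMove first h).other

/-- The edges removed so far, that is, those picked by Breaker. -/
def removed (first : Player) : History V → Set (Sym2 V)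
  | [] => ∅
  | e :: h => {f | (toMove first h = Player.breaker ∧ f = e) ∨ f ∈ removed first h}

/-- The edges of `G` that are still available for play, that is, not yet picked by either player. -/
def available (G : SimpleGraph V) (h : History V) : Set (Sym2 V) :=
  {e | e ∈ G.edgeSet ∧ e ∉ h}

/-- A strategy (for either player): with full knowledge of the graph and of all earlier moves it
picks an available edge, as long as there is one. -/
structure Strategy (G : SimpleGraph V) where
  next : History V → Sym2 V
  next_mem : ∀ h : History V, (available G h).Nonempty → next h ∈ available G h

open Classical in
/-- The play in which Breaker uses the strategy `σ` and Maker the strategy `τ`: the history after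
`n` moves. Play stops when no edge is available. -/
noncomputable def play {G : SimpleGraph V} (first : Player) (σ τ : Strategy G) : ℕ → History V
  | 0 => []
  | n + 1 =>
    let h := play first σ τ n
    if (available G h).Nonempty then
      match toMove first h with
      | .breaker => σ.next h :: h
      | .maker => τ.next h :: h
    else h

/-- The vertices that can be reached from the origin `o` in `G` without using an edge of `R`. -/
def component (G : SimpleGraph V) (o : V) (R : Set (Sym2 V)) : Set V :=
  {v | (G.deleteEdges R).Reachable o v}

/-- Breaker wins the game on `G` with origin `o` under optimal play when the player `first` starts:
Breaker has a strategy which, against every strategy of Maker, at some point of the play makes the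
removed edges separate a finite component containing `o` from the rest of `G`. -/
def BreakerWins (G : SimpleGraph V) (o : V) (first : Player) : Prop :=
  ∃ σ : Strategy G, ∀ τ : Strategy G, ∃ n : ℕ,
    (component G o (removed first (play first σ τ n))).Finite

end MakerBreaker

namespace GaltonWatson

/-- Individuals are finite words over `ℕ`: the root is the empty word and `u ++ [i]` is child number
`i` of `u`. If the individual `u` has `c u` children, `IsNode c` says which words occur. -/
inductive IsNode (c : List ℕ → ℕ) : List ℕ → Prop
  | root : IsNode c []
  | child {u : List ℕ} {i : ℕ} (hu : IsNode c u) (hi : i < c u) : IsNode c (u ++ [i])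

/-- The family tree with offspring numbers `c`: parent and child are linked by an edge. (Words that
do not occur in the tree are isolated and play no role.) -/
def familyTree (c : List ℕ → ℕ) : SimpleGraph (List ℕ) where
  Adj u v := IsNode c u ∧ IsNode c v ∧ ∃ i : ℕ, v = u ++ [i] ∨ u = v ++ [i]
  symm := ⟨fun _ _ ⟨hu, hv, i, h⟩ => ⟨hv, hu, i, h.symm⟩⟩
  loopless := ⟨fun u ⟨_, _, i, h⟩ => by simp at h⟩

/-- `ξ` is a family of independent random variables with common distribution `ν`: the numbers of
children of the individuals. -/
structure IsOffspringFamily {Ω : Type*} [MeasurableSpace Ω] (P : Measure Ω) (ν : PMF ℕ)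
    (ξ : List ℕ → Ω → ℕ) : Prop where
  measurable : ∀ u, Measurable (ξ u)
  indep : iIndepFun ξ P
  law : ∀ u, P.map (ξ u) = ν.toMeasure

/-- The event that Breaker wins the game on the Galton-Watson tree, which both players know from the
start, when the player `first` starts. -/
def breakerWinsEvent {Ω : Type*} (ξ : List ℕ → Ω → ℕ) (first : MakerBreaker.Player) : Set Ω :=
  {ω | MakerBreaker.BreakerWins (familyTree fun u => ξ u ω) [] first}

/-- The probability generating function of `ν`. -/
noncomputable def pgf (ν : PMF ℕ) (x : ℝ) : ℝ :=
  ∑' k : ℕ, (ν k).toReal * x ^ k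

end GaltonWatson

/-! Breaker, moving first, wins exactly when the tree contains no infinite binary subtree rooted at
the origin. Since offspring numbers are finite, this means that some `n` satisfies `NoBinary c n
[]`. If such a binary subtree exists, Maker pairs the two child edges at each of its vertices and
answers one by the other. Breaker never gets both, so the component stays infinite
(`not_breakerWins_of_pairs`). If Maker starts, a child of the origin carrying such a subtree
suffices: he first takes the edge to it. If there is none, some child of the origin is such that all
the others carry no binary subtree of a fixed depth. Breaker cuts the exceptional child and then
answers locally, so that Maker's component of the origin stays above a fixed level
(`Safe.exists_response`). If Maker starts, there must be no exceptional child at all. Let `B u` be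
the event that `u` roots no infinite binary subtree; its probability `p` does not depend on `u`. The
event `B u` says that at most one child fails `B`, and these children are independent. Hence `p` is
the sum of `p_k (p^k + k (1 - p) p^(k-1))`, which is `g(p) + (1 - p) g'(p)` for `p < 1`. When Maker
starts, no child of the origin may fail, which gives `g(p)`. -/

namespace MakerBreaker

/-! ### Bounded forcing, strategies and invariants in the edge game -/

variable {V : Type*} {G : SimpleGraph V} {o : V} {first : Player}

/-- After the moves `h` Breaker can separate a finite component within `k` further moves. -/
def ForcesWithin (G : SimpleGraph V) (o : V) (first : Player) : ℕ → History V → Prop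
  | 0, h => (component G o (removed first h)).Finite
  | k + 1, h => (component G o (removed first h)).Finite ∨
      (toMove first h = .breaker ∧ ∃ e ∈ available G h, ForcesWithin G o first k (e :: h)) ∨
      (toMove first h = .maker ∧ (available G h).Nonempty ∧
        ∀ e ∈ available G h, ForcesWithin G o first k (e :: h))

theorem ForcesWithin.of_finite {h : History V} (hf : (component G o (removed first h)).Finite) :
    ∀ k, ForcesWithin G o first k h
  | 0 => hf
  | _ + 1 => Or.inl hf

/-- A partial choice of available moves extends to a strategy. -/
theorem exists_strategy (o : V) (Q : History V → Sym2 V → Prop) :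
    ∃ σ : Strategy G, ∀ h, (∃ e ∈ available G h, Q h e) →
      σ.next h ∈ available G h ∧ Q h (σ.next h) := by
  classical
  have key : ∀ h : History V, ∃ e, ((available G h).Nonempty → e ∈ available G h) ∧
      ((∃ e ∈ available G h, Q h e) → e ∈ available G h ∧ Q h e) := by
    intro h
    by_cases h1 : ∃ e ∈ available G h, Q h e
    · obtain ⟨e, he, hq⟩ := h1
      exact ⟨e, fun _ => he, fun _ => ⟨he, hq⟩⟩
    · by_cases h2 : (available G h).Nonempty
      · obtain ⟨e, he⟩ := h2
        exact ⟨e, fun _ => he, fun h => absurd h h1⟩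
      · exact ⟨s(o, o), fun h => absurd h h2, fun h => absurd h h1⟩
  choose f hf using key
  exact ⟨⟨f, fun h => (hf h).1⟩, fun h => (hf h).2⟩

theorem play_succ_breaker {σ τ : Strategy G} {n : ℕ}
    (ha : (available G (play first σ τ n)).Nonempty)
    (ht : toMove first (play first σ τ n) = .breaker) :
    play first σ τ (n + 1) = σ.next (play first σ τ n) :: play first σ τ n := by
  simp [play, ha, ht]

theorem play_succ_maker {σ τ : Strategy G} {n : ℕ}
    (ha : (available G (play first σ τ n)).Nonempty)
    (ht : toMove first (play first σ τ n) = .maker) :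
    play first σ τ (n + 1) = τ.next (play first σ τ n) :: play first σ τ n := by
  simp [play, ha, ht]

theorem play_succ_of_empty {σ τ : Strategy G} {n : ℕ}
    (ha : ¬ (available G (play first σ τ n)).Nonempty) :
    play first σ τ (n + 1) = play first σ τ n := by
  simp [play, ha]

/-- A strategy sees the history but not the remaining budget `k`. It therefore picks an edge after
which the least sufficient budget is smallest; this is at most the budget promised by any other
edge, so the budget strictly decreases along the play. -/
theorem breakerWins_of_forcesWithin {k : ℕ} (hk : ForcesWithin G o first k []) :
    BreakerWins G o first := by
  classical
  obtain ⟨σ, hσ⟩ := exists_strategy (G := G) o fun h e =>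
    ∃ m, ForcesWithin G o first m (e :: h) ∧
      ∀ m' e', e' ∈ available G h → ForcesWithin G o first m' (e' :: h) → m ≤ m'
  refine ⟨σ, fun τ => ?_⟩
  suffices H : ∀ k n, ForcesWithin G o first k (play first σ τ n) →
      ∃ m, (component G o (removed first (play first σ τ m))).Finite from H k 0 hk
  intro k
  induction k using Nat.strong_induction_on with
  | _ k ih =>
    intro n hn
    cases k with
    | zero => exact ⟨n, hn⟩
    | succ k =>
      rcases hn with hn | ⟨ht, e, he, hn⟩ | ⟨ht, ha, hn⟩
      · exact ⟨n, hn⟩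
      · have hex : ∃ m, ∃ e ∈ available G (play first σ τ n),
            ForcesWithin G o first m (e :: play first σ τ n) := ⟨k, e, he, hn⟩
        obtain ⟨e', he', hn'⟩ := Nat.find_spec hex
        obtain ⟨-, m, hm, hmin⟩ := hσ (play first σ τ n) ⟨e', he', Nat.find hex, hn', fun m' e'' h1 h2 =>
          Nat.find_min' hex ⟨e'', h1, h2⟩⟩
        rw [← play_succ_breaker ⟨e, he⟩ ht] at hm
        exact ih m (Nat.lt_succ_of_le (hmin k e he hn)) (n + 1) hm
      · have := hn _ (τ.next_mem _ ha)
        rw [← play_succ_maker ha ht] at this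
        exact ih k (Nat.lt_succ_self k) (n + 1) this

/-- Maker wins if he can maintain an invariant that excludes finite components. -/
theorem not_breakerWins_of_invariant (I : History V → Prop) (h0 : I [])
    (hinf : ∀ h, I h → ¬ (component G o (removed first h)).Finite)
    (hb : ∀ h, I h → toMove first h = .breaker → ∀ e ∈ available G h, I (e :: h))
    (hm : ∀ h, I h → toMove first h = .maker → (available G h).Nonempty →
      ∃ e ∈ available G h, I (e :: h)) :
    ¬ BreakerWins G o first := by
  rintro ⟨σ, hσ⟩
  obtain ⟨τ, hτ⟩ := exists_strategy (G := G) o fun h e => I (e :: h)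
  obtain ⟨n, hn⟩ := hσ τ
  suffices H : ∀ n, I (play first σ τ n) from hinf _ (H n) hn
  intro n
  induction n with
  | zero => exact h0
  | succ n ih =>
    by_cases ha : (available G (play first σ τ n)).Nonempty
    · cases ht : toMove first (play first σ τ n) with
      | maker =>
        rw [play_succ_maker ha ht]
        exact (hτ _ (hm _ ih ht ha)).2
      | breaker =>
        rw [play_succ_breaker ha ht]
        exact hb _ ih ht _ (σ.next_mem _ ha)
    · rwa [play_succ_of_empty ha]

theorem mem_of_mem_removed {e : Sym2 V} : ∀ {h : History V}, e ∈ removed first h → e ∈ h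
  | [], he => he.elim
  | f :: h, he => by
    rcases he with ⟨-, rfl⟩ | he
    · exact List.mem_cons_self
    · exact List.mem_cons_of_mem _ (mem_of_mem_removed he)

theorem mem_removed_cons {e f : Sym2 V} {h : History V} :
    e ∈ removed first (f :: h) ↔ (toMove first h = .breaker ∧ e = f) ∨ e ∈ removed first h :=
  Iff.rfl

theorem toMove_cons_of_maker {e : Sym2 V} {h : History V} (ht : toMove first h = .maker) :
    toMove first (e :: h) = .breaker := by simp [toMove, ht, Player.other]

theorem toMove_cons_of_breaker {e : Sym2 V} {h : History V} (ht : toMove first h = .breaker) :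
    toMove first (e :: h) = .maker := by simp [toMove, ht, Player.other]

end MakerBreaker

/-! ### Binary subtrees and Breaker's local response -/

namespace GaltonWatson

open MakerBreaker

variable {c : List ℕ → ℕ}

/-- The subtree at `u` contains no binary tree of depth `n` with root `u`. -/
def NoBinary (c : List ℕ → ℕ) : ℕ → List ℕ → Prop
  | 0, _ => False
  | n + 1, u => ∃ j, ∀ i < c u, i ≠ j → NoBinary c n (u ++ [i])

theorem NoBinary.succ : ∀ {n : ℕ} {u : List ℕ}, NoBinary c n u → NoBinary c (n + 1) u
  | 0, _, h => h.elim
  | _ + 1, _, ⟨j, hj⟩ => ⟨j, fun i hi hij => (hj i hi hij).succ⟩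

theorem NoBinary.mono {n m : ℕ} {u : List ℕ} (h : NoBinary c n u) (hnm : n ≤ m) :
    NoBinary c m u := by
  induction hnm with
  | refl => exact h
  | step _ ih => exact ih.succ

theorem exists_forall_noBinary {u : List ℕ} {s : Finset ℕ}
    (h : ∀ i ∈ s, ∃ n, NoBinary c n (u ++ [i])) : ∃ n, ∀ i ∈ s, NoBinary c n (u ++ [i]) := by
  induction s using Finset.induction_on with
  | empty => exact ⟨0, by simp⟩
  | insert a s _ ih =>
    obtain ⟨n, hn⟩ := ih fun i hi => h i (Finset.mem_insert_of_mem hi)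
    obtain ⟨m, hm⟩ := h a (Finset.mem_insert_self a s)
    refine ⟨max n m, fun i hi => ?_⟩
    rcases Finset.mem_insert.1 hi with rfl | hi
    · exact hm.mono (le_max_right _ _)
    · exact (hn i hi).mono (le_max_left _ _)

theorem exists_noBinary_iff {u : List ℕ} :
    (∃ n, NoBinary c n u) ↔ ∃ j, ∀ i < c u, i ≠ j → ∃ n, NoBinary c n (u ++ [i]) := by
  constructor
  · rintro ⟨_ | n, hn⟩
    · exact hn.elim
    · obtain ⟨j, hj⟩ := hn
      exact ⟨j, fun i hi hij => ⟨n, hj i hi hij⟩⟩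
  · rintro ⟨j, hj⟩
    obtain ⟨n, hn⟩ := exists_forall_noBinary (c := c) (u := u) (s := (Finset.range (c u)).erase j)
      fun i hi => hj i (by simpa using (Finset.mem_erase.1 hi).2) (Finset.mem_erase.1 hi).1
    exact ⟨n + 1, j, fun i hi hij => hn i (by simp [hi, hij])⟩

theorem isNode_append_iff {u : List ℕ} {i : ℕ} : IsNode c (u ++ [i]) ↔ IsNode c u ∧ i < c u := by
  constructor
  · intro h
    generalize hw : u ++ [i] = w at h
    cases h with
    | root => simp at hw
    | child hu hi =>
      obtain ⟨rfl, h2⟩ := List.append_inj' hw rfl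
      obtain rfl : i = _ := by simpa using h2
      exact ⟨hu, hi⟩
  · exact fun h => h.1.child h.2

theorem finite_isNode_length_le (c : List ℕ → ℕ) (n : ℕ) :
    {w | IsNode c w ∧ w.length ≤ n}.Finite := by
  induction n with
  | zero =>
    refine (Set.finite_singleton ([] : List ℕ)).subset fun w hw => ?_
    simpa using hw.2
  | succ n ih =>
    refine (ih.union (ih.biUnion fun u _ =>
      ((Set.finite_Iio (c u)).image fun i => u ++ [i]))).subset fun w hw => ?_
    obtain ⟨h1, h2⟩ := hw
    cases h1 with
    | root => exact Or.inl ⟨.root, by simp⟩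
    | @child u i hu hi =>
      refine Or.inr (Set.mem_biUnion (x := u) ⟨hu, ?_⟩ ⟨i, hi, rfl⟩)
      simpa using h2

theorem eq_or_prefix_of_prefix_append {v w : List ℕ} {i : ℕ} (h : v <+: w ++ [i]) :
    v = w ++ [i] ∨ v <+: w := by
  rcases List.prefix_concat_iff.1 (by simpa using h) with h | h
  · exact Or.inl (by simpa using h)
  · exact Or.inr h

/-- All nonempty prefixes of `w` lie in `M`: the path from the root to `w` belongs to Maker. -/
def Linked (M : Set (List ℕ)) (w : List ℕ) : Prop :=
  ∀ v, v <+: w → v ≠ [] → v ∈ M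

theorem Linked.of_prefix {M : Set (List ℕ)} {v w : List ℕ} (h : Linked M w) (hv : v <+: w) :
    Linked M v := fun x hx => h x (hx.trans hv)

theorem linked_nil (M : Set (List ℕ)) : Linked M [] := fun v hv h => by simp_all

theorem Linked.append {M : Set (List ℕ)} {w : List ℕ} {i : ℕ} (h : Linked M w)
    (hi : w ++ [i] ∈ M) : Linked M (w ++ [i]) := by
  intro v hv hne
  rcases eq_or_prefix_of_prefix_append hv with rfl | hv
  · exact hi
  · exact h v hv hne

/-- The unpicked edges at the component of Maker's edges that contains the root, if Maker owns
the edges above `M` and the edges above `F` are unpicked. -/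
def boundary (M F : Set (List ℕ)) : Set (List ℕ) :=
  {y | y ∈ F ∧ ∃ w i, y = w ++ [i] ∧ Linked M w}

/-- The positions with Maker to move in which Breaker can keep Maker's component of the root above
level `n`. -/
def Safe (c : List ℕ → ℕ) (n : ℕ) (M F : Set (List ℕ)) : Prop :=
  ∀ w, Linked M w → w.length < n ∧
    ∀ i, w ++ [i] ∈ F → NoBinary c (n - w.length - 1) (w ++ [i]) ∧ ∀ x ∈ M, ¬ w ++ [i] <+: x

theorem Safe.of_boundary {n : ℕ} {M F F' : Set (List ℕ)} (h : Safe c n M F)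
    (hF : boundary M F' ⊆ F) : Safe c n M F' := fun w hw =>
  ⟨(h w hw).1, fun i hi => (h w hw).2 i (hF ⟨hi, w, i, rfl, hw⟩)⟩

/-- If Maker extends his component of the root, Breaker cuts the exceptional child of the new
vertex. If Maker plays elsewhere, Breaker cuts the only boundary edge, if any, above the new edge,
so that no Maker edge waits below the boundary. -/
theorem Safe.exists_response {n : ℕ} {M F : Set (List ℕ)} (h : Safe c n M F)
    (hF : ∀ w i, w ++ [i] ∈ F → i < c w) {w : List ℕ} {i : ℕ} (hx : w ++ [i] ∈ F) :
    ∃ y, Safe c n (insert (w ++ [i]) M) ((F \ {w ++ [i]}) \ {y}) := by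
  by_cases hw : Linked M w
  · obtain ⟨hl, hc⟩ := h w hw
    obtain ⟨hW, hM⟩ := hc i hx
    -- `NoBinary` is false at depth `0`, so there is room for one more level.
    obtain ⟨k, hk⟩ : ∃ k, n - w.length - 1 = k + 1 := by
      cases hk : n - w.length - 1 with
      | zero => rw [hk] at hW; exact hW.elim
      | succ k => exact ⟨k, rfl⟩
    rw [hk] at hW
    obtain ⟨j, hj⟩ := hW
    refine ⟨w ++ [i] ++ [j], fun v hv => ?_⟩
    by_cases hvM : Linked M v
    · refine ⟨(h v hvM).1, fun i' hi' => ?_⟩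
      obtain ⟨h1, h2⟩ := (h v hvM).2 i' hi'.1.1
      refine ⟨h1, fun x hxM hpre => ?_⟩
      rcases hxM with rfl | hxM
      · rcases eq_or_prefix_of_prefix_append hpre with heq | hpre
        · exact hi'.1.2 heq
        · exact h2 _ (hw _ hpre (by simp)) List.prefix_rfl
      · exact h2 x hxM hpre
    -- Maker owned nothing below `w ++ [i]`, so this is the only newly linked vertex.
    · obtain rfl : v = w ++ [i] := by
        have hxv : w ++ [i] <+: v := by
          by_contra hcon
          exact hvM fun z hz hne => (hv z hz hne).resolve_left fun h => hcon (h ▸ hz)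
        by_contra hne
        rcases hv v List.prefix_rfl (by rintro rfl; simp at hxv) with h | h
        · exact hne h
        · exact hM v h hxv
      refine ⟨by simp; omega, fun i' hi' => ⟨?_, ?_⟩⟩
      · have : n - (w ++ [i]).length - 1 = k := by simp; omega
        rw [this]
        exact hj i' (hF _ _ hi'.1.1) fun hcon => hi'.2 (by rw [hcon]; rfl)
      · rintro x (rfl | hxM) hpre
        · simpa using hpre.length_le
        · exact hM x hxM ((List.prefix_append _ _).trans hpre)
  -- An edge not attached to Maker's component links no new vertex.
  · have hL : ∀ v, Linked (insert (w ++ [i]) M) v → Linked M v := by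
      intro v hv z hz hne
      refine (hv z hz hne).resolve_left ?_
      rintro rfl
      refine hw fun z' hz' hne' => ?_
      refine (hv z' (hz'.trans ((List.prefix_append _ _).trans hz)) hne').resolve_left ?_
      rintro rfl
      simpa using hz'.length_le
    -- Two distinct boundary edges above `w` would be nested. The lower one hangs from a linked
    -- vertex, so the upper one would already be Maker's, which `Safe` excludes.
    have hU : ∀ v k v' k', Linked M v → Linked M v' → v ++ [k] ∈ F → v' ++ [k'] ∈ F →
        v ++ [k] <+: w → v' ++ [k'] <+: w → v ++ [k] = v' ++ [k'] := by
      intro v k v' k' hv hv' hk hk' hp hp'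
      rcases List.prefix_or_prefix_of_prefix hp hp' with hq | hq
      · rcases eq_or_prefix_of_prefix_append hq with hq | hq
        · exact hq
        · exact absurd List.prefix_rfl (((h v hv).2 k hk).2 _ (hv' _ hq (by simp)))
      · rcases eq_or_prefix_of_prefix_append hq with hq | hq
        · exact hq.symm
        · exact absurd List.prefix_rfl (((h v' hv').2 k' hk').2 _ (hv _ hq (by simp)))
    obtain ⟨y, hy⟩ : ∃ y, ∀ v k, Linked M v → v ++ [k] ∈ F → v ++ [k] <+: w → v ++ [k] = y := by
      by_cases hex : ∃ v k, Linked M v ∧ v ++ [k] ∈ F ∧ v ++ [k] <+: w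
      · obtain ⟨v, k, hv, hk, hp⟩ := hex
        exact ⟨v ++ [k], fun v' k' hv' hk' hp' => hU _ _ _ _ hv' hv hk' hk hp' hp⟩
      -- No cut is needed here; the empty word stands for no edge.
      · exact ⟨[], fun v k hv hk hp => absurd ⟨v, k, hv, hk, hp⟩ hex⟩
    refine ⟨y, fun v hv => ⟨(h v (hL v hv)).1, fun k hk => ?_⟩⟩
    obtain ⟨h1, h2⟩ := (h v (hL v hv)).2 k hk.1.1
    refine ⟨h1, ?_⟩
    rintro x (rfl | hxM) hpre
    · rcases eq_or_prefix_of_prefix_append hpre with heq | hpre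
      · exact hk.1.2 heq
      · exact hk.2 (hy v k (hL v hv) hk.1.1 hpre)
    · exact h2 x hxM hpre

/-- Once a response `y` is known, Breaker can choose it on the boundary, unless that is empty. -/
theorem Safe.exists_boundary_response {n : ℕ} {M F : Set (List ℕ)} {y : List ℕ}
    (h : Safe c n M (F \ {y})) (hne : (boundary M F).Nonempty) :
    ∃ z ∈ boundary M F, Safe c n M (F \ {z}) := by
  by_cases hy : y ∈ boundary M F
  · exact ⟨y, hy, h⟩
  · obtain ⟨z, hz⟩ := hne
    refine ⟨z, hz, h.of_boundary ?_⟩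
    rintro x ⟨hx, hxw⟩
    refine ⟨hx.1, ?_⟩
    rintro rfl
    exact hy ⟨hx.1, hxw⟩

/-! ### Positions of the game as sets of words -/

/-- The edge between the nonempty word `w` and its parent. -/
def parentEdge (w : List ℕ) : Sym2 (List ℕ) := s(w.dropLast, w)

theorem parentEdge_append (u : List ℕ) (i : ℕ) : parentEdge (u ++ [i]) = s(u, u ++ [i]) := by
  simp [parentEdge]

theorem parentEdge_inj {v w : List ℕ} (hv : v ≠ []) (hw : w ≠ [])
    (h : parentEdge v = parentEdge w) : v = w := by
  obtain ⟨v, i, rfl⟩ := (List.eq_nil_or_concat' v).resolve_left hv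
  obtain ⟨w, j, rfl⟩ := (List.eq_nil_or_concat' w).resolve_left hw
  rw [parentEdge_append, parentEdge_append, Sym2.eq_iff] at h
  rcases h with h | ⟨h1, h2⟩
  · exact h.2
  · have h3 := congrArg List.length h1
    have h4 := congrArg List.length h2
    simp at h3 h4
    omega

theorem familyTree_adj_append {u : List ℕ} {i : ℕ} (h : IsNode c (u ++ [i])) :
    (familyTree c).Adj u (u ++ [i]) := ⟨(isNode_append_iff.1 h).1, h, i, Or.inl rfl⟩

/-- The individuals, other than the root, whose edge to the parent is unpicked. -/
def freeWords (c : List ℕ → ℕ) (h : History (List ℕ)) : Set (List ℕ) :=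
  {w | w ≠ [] ∧ IsNode c w ∧ parentEdge w ∉ h}

/-- The individuals, other than the root, whose edge to the parent belongs to Maker. -/
def makerWords (c : List ℕ → ℕ) (first : Player) (h : History (List ℕ)) : Set (List ℕ) :=
  {w | w ≠ [] ∧ IsNode c w ∧ parentEdge w ∈ h ∧ parentEdge w ∉ removed first h}

theorem mem_available_iff {h : History (List ℕ)} {e : Sym2 (List ℕ)} :
    e ∈ available (familyTree c) h ↔ ∃ w ∈ freeWords c h, e = parentEdge w := by
  constructor
  · rintro ⟨he, hh⟩
    induction e using Sym2.ind with
    | _ u v =>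
      obtain ⟨hu, hv, i, h1⟩ := he
      dsimp only at hu hv h1
      rcases h1 with rfl | rfl
      · exact ⟨_, ⟨by simp, hv, by rwa [parentEdge_append]⟩, (parentEdge_append _ _).symm⟩
      · rw [Sym2.eq_swap] at hh ⊢
        exact ⟨_, ⟨by simp, hu, by rwa [parentEdge_append]⟩, (parentEdge_append _ _).symm⟩
  · rintro ⟨w, ⟨hne, hw, hh⟩, rfl⟩
    obtain ⟨w, j, rfl⟩ := (List.eq_nil_or_concat' w).resolve_left hne
    refine ⟨?_, hh⟩
    rw [parentEdge_append]
    exact familyTree_adj_append hw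

variable {first : Player} {h : History (List ℕ)}

theorem freeWords_cons {x : List ℕ} (hx : x ≠ []) :
    freeWords c (parentEdge x :: h) = freeWords c h \ {x} := by
  ext w
  constructor
  · rintro ⟨h1, h2, h3⟩
    rw [List.mem_cons, not_or] at h3
    exact ⟨⟨h1, h2, h3.2⟩, fun hwx => h3.1 (by rw [hwx])⟩
  · rintro ⟨⟨h1, h2, h3⟩, h4⟩
    refine ⟨h1, h2, ?_⟩
    rw [List.mem_cons, not_or]
    exact ⟨fun hwx => h4 (parentEdge_inj h1 hx hwx), h3⟩

theorem makerWords_cons_of_maker (ht : toMove first h = .maker) {x : List ℕ}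
    (hx : x ∈ freeWords c h) :
    makerWords c first (parentEdge x :: h) = insert x (makerWords c first h) := by
  ext w
  simp only [makerWords, Set.mem_ofPred_eq, mem_removed_cons, ht, List.mem_cons, Set.mem_insert_iff]
  constructor
  · rintro ⟨h1, h2, h3 | h3, h4⟩
    · exact Or.inl (parentEdge_inj h1 hx.1 h3)
    · exact Or.inr ⟨h1, h2, h3, by simpa using h4⟩
  · rintro (rfl | ⟨h1, h2, h3, h4⟩)
    · exact ⟨hx.1, hx.2.1, Or.inl rfl, by simpa using fun hr => hx.2.2 (mem_of_mem_removed hr)⟩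
    · exact ⟨h1, h2, Or.inr h3, by simpa using h4⟩

theorem makerWords_cons_of_breaker (ht : toMove first h = .breaker) {x : List ℕ}
    (hx : x ∈ freeWords c h) :
    makerWords c first (parentEdge x :: h) = makerWords c first h := by
  ext w
  simp only [makerWords, Set.mem_ofPred_eq, mem_removed_cons, ht, List.mem_cons, true_and, not_or]
  constructor
  · rintro ⟨h1, h2, h3 | h3, h4⟩
    · exact absurd h3 h4.1
    · exact ⟨h1, h2, h3, h4.2⟩
  · rintro ⟨h1, h2, h3, h4⟩
    exact ⟨h1, h2, Or.inr h3, fun hwx => hx.2.2 (hwx ▸ h3), h4⟩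

/-- Without unpicked boundary edges, every surviving edge leading down from a linked vertex is
Maker's. All reachable vertices are thus linked and lie above level `n`, where the tree is finite.
-/
theorem finite_component_of_boundary_empty {n : ℕ}
    (hb : ¬ (boundary (makerWords c first h) (freeWords c h)).Nonempty)
    (hl : ∀ w, Linked (makerWords c first h) w → w.length < n) :
    (component (familyTree c) [] (removed first h)).Finite := by
  have key : ∀ v, ((familyTree c).deleteEdges (removed first h)).Reachable [] v →
      IsNode c v ∧ Linked (makerWords c first h) v := by
    suffices H : ∀ u v, ((familyTree c).deleteEdges (removed first h)).Walk u v →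
        IsNode c u ∧ Linked (makerWords c first h) u →
        IsNode c v ∧ Linked (makerWords c first h) v from
      fun v ⟨p⟩ => H [] v p ⟨.root, linked_nil _⟩
    intro u v p
    induction p with
    | nil => exact id
    | @cons u w v huw _ ih =>
      rintro ⟨hu, hL⟩
      refine ih ?_
      rw [SimpleGraph.deleteEdges_adj] at huw
      obtain ⟨⟨-, hw, i, rfl | rfl⟩, hr⟩ := huw
      · refine ⟨hw, hL.append ?_⟩
        rw [← parentEdge_append] at hr
        refine ⟨by simp, hw, ?_, hr⟩
        by_contra hf
        exact hb ⟨u ++ [i], ⟨by simp, hw, hf⟩, u, i, rfl, hL⟩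
      · exact ⟨hw, hL.of_prefix (List.prefix_append _ _)⟩
  exact (finite_isNode_length_le c n).subset fun v hv =>
    ⟨(key v hv).1, (hl v (key v hv).2).le⟩

/-- The unpicked edges down to level `n` serve as a clock. Breaker always replies on the boundary,
which lies within that level, so each round of two moves lowers their number even if Maker plays
deeper. -/
theorem forcesWithin_of_safe {n : ℕ} : ∀ (m : ℕ) (h : History (List ℕ)), toMove first h = .maker →
    Safe c n (makerWords c first h) (freeWords c h) →
    (freeWords c h ∩ {w | w.length ≤ n}).ncard ≤ m →
    ForcesWithin (familyTree c) [] first (2 * m + 1) h := by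
  have hfin : ∀ h, (freeWords c h ∩ {w | w.length ≤ n}).Finite := fun h =>
    (finite_isNode_length_le c n).subset fun w hw => ⟨hw.1.2.1, hw.2⟩
  have hlen : ∀ {M F : Set (List ℕ)}, (∀ w, Linked M w → w.length < n) →
      ∀ y ∈ boundary M F, y.length ≤ n := by
    rintro M F hl y ⟨-, w, i, rfl, hw⟩
    simpa using hl w hw
  intro m
  induction m with
  | zero =>
    intro h _ hs hm
    refine .of_finite (finite_component_of_boundary_empty ?_ fun w hw => (hs w hw).1) _
    rintro ⟨y, hy⟩
    have := (Set.ncard_eq_zero (hfin h)).1 (Nat.le_zero.1 hm)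
    exact (this ▸ (⟨hy.1, hlen (fun w hw => (hs w hw).1) y hy⟩ :
      y ∈ freeWords c h ∩ {w | w.length ≤ n}) : y ∈ (∅ : Set (List ℕ)))
  | succ m ih =>
    intro h ht hs hm
    by_cases hb : (boundary (makerWords c first h) (freeWords c h)).Nonempty
    swap
    · exact .of_finite (finite_component_of_boundary_empty hb fun w hw => (hs w hw).1) _
    refine Or.inr (Or.inr ⟨ht, ?_, ?_⟩)
    · obtain ⟨y, hy⟩ := hb
      exact ⟨_, mem_available_iff.2 ⟨y, hy.1, rfl⟩⟩
    intro e he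
    obtain ⟨x, hx, rfl⟩ := mem_available_iff.1 he
    obtain ⟨w, i, rfl⟩ := (List.eq_nil_or_concat' x).resolve_left hx.1
    obtain ⟨y, hy⟩ := hs.exists_response
      (fun w i hwi => (isNode_append_iff.1 hwi.2.1).2) hx
    have hM := makerWords_cons_of_maker ht hx
    have hF := freeWords_cons (c := c) (h := h) hx.1
    rw [← hM, ← hF] at hy
    by_cases hb' : (boundary (makerWords c first (parentEdge (w ++ [i]) :: h))
      (freeWords c (parentEdge (w ++ [i]) :: h))).Nonempty
    swap
    · exact .of_finite (finite_component_of_boundary_empty hb' fun w hw => (hy w hw).1) _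
    obtain ⟨z, hz, hsz⟩ := hy.exists_boundary_response hb'
    have ht' := toMove_cons_of_maker (e := parentEdge (w ++ [i])) ht
    refine Or.inr (Or.inl ⟨ht', parentEdge z, mem_available_iff.2 ⟨z, hz.1, rfl⟩, ?_⟩)
    rw [← makerWords_cons_of_breaker ht' hz.1, ← freeWords_cons hz.1.1] at hsz
    refine ih _ (toMove_cons_of_breaker ht') hsz (Nat.lt_succ_iff.1 (lt_of_lt_of_le ?_ hm))
    refine Set.ncard_lt_ncard ?_ (hfin h)
    refine ⟨fun v hv => ⟨?_, hv.2⟩, fun hsub => ?_⟩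
    · have := hv.1
      rw [freeWords_cons hz.1.1, hF] at this
      exact this.1.1
    · have hzh : z ∈ freeWords c h := by
        have := hz.1
        rw [hF] at this
        exact this.1
      have := (hsub ⟨hzh, hlen (fun w hw => (hy w hw).1) z hz⟩).1
      rw [freeWords_cons hz.1.1] at this
      exact this.2 rfl

theorem makerWords_nil : makerWords c first [] = ∅ := by
  ext w; simp [makerWords]

theorem linked_empty {w : List ℕ} (hw : Linked ∅ w) : w = [] := by
  by_contra hne
  exact hw w List.prefix_rfl hne

theorem breakerWins_maker_of_noBinary (hc : ∀ i < c [], ∃ n, NoBinary c n [i]) :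
    BreakerWins (familyTree c) [] .maker := by
  obtain ⟨n, hn⟩ := exists_forall_noBinary (c := c) (u := []) (s := Finset.range (c []))
    (by simpa using hc)
  refine breakerWins_of_forcesWithin (forcesWithin_of_safe (n := n + 1) _ [] rfl ?_ le_rfl)
  intro w hw
  rw [makerWords_nil] at hw ⊢
  obtain rfl := linked_empty hw
  exact ⟨by simp, fun i hi =>
    ⟨by simpa using hn i (by simpa using (isNode_append_iff.1 hi.2.1).2), by simp⟩⟩

theorem breakerWins_breaker_of_noBinary {n : ℕ} (hc : NoBinary c n []) :
    BreakerWins (familyTree c) [] .breaker := by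
  cases n with
  | zero => exact hc.elim
  | succ n =>
    obtain ⟨j, hj⟩ := hc
    -- Cutting the exceptional child `[j]` makes the start safe; the other children sit at level one
    -- and keep depth `n`.
    have hs : Safe c (n + 1) (makerWords c .breaker []) (freeWords c [] \ {[j]}) := by
      intro w hw
      rw [makerWords_nil] at hw ⊢
      obtain rfl := linked_empty hw
      refine ⟨by simp, fun i hi => ⟨?_, by simp⟩⟩
      simpa using hj i (isNode_append_iff.1 hi.1.2.1).2 fun hij => hi.2 (by simp [hij])
    by_cases hb : (boundary (makerWords c .breaker []) (freeWords c [])).Nonempty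
    · obtain ⟨z, hz, hsz⟩ := hs.exists_boundary_response hb
      rw [← makerWords_cons_of_breaker rfl hz.1, ← freeWords_cons hz.1.1] at hsz
      exact breakerWins_of_forcesWithin (k := _ + 1) (Or.inr (Or.inl ⟨rfl, parentEdge z,
        mem_available_iff.2 ⟨z, hz.1, rfl⟩, forcesWithin_of_safe _ _ rfl hsz le_rfl⟩))
    · exact breakerWins_of_forcesWithin (k := 0)
        (finite_component_of_boundary_empty hb fun w hw => (hs w hw).1)

end GaltonWatson

/-! ### Maker's pairing strategy on a binary subtree -/

namespace GaltonWatson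

open MakerBreaker

variable {c : List ℕ → ℕ}

/-- `a` and `b` are the two children of an individual of `D` that `l` and `r` select. -/
def IsPair (D : Set (List ℕ)) (l r : List ℕ → ℕ) (a b : List ℕ) : Prop :=
  ∃ u ∈ D, (a = u ++ [l u] ∧ b = u ++ [r u]) ∨ (a = u ++ [r u] ∧ b = u ++ [l u])

section Pairing

variable {D : Set (List ℕ)} {l r : List ℕ → ℕ}

theorem IsPair.symm {a b : List ℕ} (h : IsPair D l r a b) : IsPair D l r b a := by
  obtain ⟨u, hu, h | h⟩ := h
  · exact ⟨u, hu, Or.inr ⟨h.2, h.1⟩⟩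
  · exact ⟨u, hu, Or.inl ⟨h.2, h.1⟩⟩

theorem IsPair.ne_nil {a b : List ℕ} (h : IsPair D l r a b) : a ≠ [] := by
  obtain ⟨u, hu, ⟨rfl, -⟩ | ⟨rfl, -⟩⟩ := h <;> simp

theorem IsPair.ne (hlr : ∀ u ∈ D, l u ≠ r u) {a b : List ℕ} (h : IsPair D l r a b) : a ≠ b := by
  obtain ⟨u, hu, ⟨rfl, rfl⟩ | ⟨rfl, rfl⟩⟩ := h
  · simpa using hlr u hu
  · simpa using (hlr u hu).symm

theorem IsPair.eq_right (hlr : ∀ u ∈ D, l u ≠ r u) {a b b' : List ℕ} (h : IsPair D l r a b)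
    (h' : IsPair D l r a b') : b = b' := by
  obtain ⟨u, hu, ⟨h1, rfl⟩ | ⟨h1, rfl⟩⟩ := h <;>
  obtain ⟨v, hv, ⟨h2, rfl⟩ | ⟨h2, rfl⟩⟩ := h' <;>
  · rw [h1] at h2
    obtain ⟨rfl, h3⟩ := List.append_inj' h2 rfl
    have h4 := hlr u hu
    simp_all

theorem IsPair.right_mem (hl : ∀ u ∈ D, u ++ [l u] ∈ D) (hr : ∀ u ∈ D, u ++ [r u] ∈ D)
    {a b : List ℕ} (h : IsPair D l r a b) : b ∈ D := by
  obtain ⟨u, hu, ⟨-, rfl⟩ | ⟨-, rfl⟩⟩ := h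
  exacts [hr u hu, hl u hu]

/-- From each vertex of `D` in the component, one of the two selected child edges survives, so the
component reaches every depth. -/
theorem infinite_component_of_pairs (hD : ∀ u ∈ D, IsNode c u)
    (hl : ∀ u ∈ D, u ++ [l u] ∈ D) (hr : ∀ u ∈ D, u ++ [r u] ∈ D)
    {R : Set (Sym2 (List ℕ))} {u₀ : List ℕ} (hu₀ : u₀ ∈ D) (h₀ : u₀ ∈ component (familyTree c) [] R)
    (hR : ∀ a b, IsPair D l r a b → ¬ (parentEdge a ∈ R ∧ parentEdge b ∈ R)) :
    ¬ (component (familyTree c) [] R).Finite := by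
  intro hfin
  have step : ∀ k, ∃ v ∈ D, v ∈ component (familyTree c) [] R ∧ k ≤ v.length := by
    intro k
    induction k with
    | zero => exact ⟨u₀, hu₀, h₀, Nat.zero_le _⟩
    | succ k ih =>
      obtain ⟨v, hv, hc, hk⟩ := ih
      have ext : ∀ i, v ++ [i] ∈ D → parentEdge (v ++ [i]) ∉ R →
          ∃ w ∈ D, w ∈ component (familyTree c) [] R ∧ k + 1 ≤ w.length := by
        intro i hi hiR
        refine ⟨v ++ [i], hi, SimpleGraph.Reachable.trans hc (SimpleGraph.Adj.reachable ?_),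
          by simpa using hk⟩
        rw [SimpleGraph.deleteEdges_adj]
        exact ⟨familyTree_adj_append (hD _ hi), by rwa [parentEdge_append] at hiR⟩
      by_cases h1 : parentEdge (v ++ [l v]) ∈ R
      · exact ext _ (hr v hv) fun h2 => hR _ _ ⟨v, hv, Or.inl ⟨rfl, rfl⟩⟩ ⟨h1, h2⟩
      · exact ext _ (hl v hv) h1
  obtain ⟨N, hN⟩ := (hfin.image List.length).bddAbove
  obtain ⟨v, -, hv, hlen⟩ := step (N + 1)
  have := hN ⟨v, hv, rfl⟩
  omega

/-- Breaker loses against the pairing strategy on a binary tree that starts at the root, or, if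
Maker starts, at a child of the root. -/
theorem not_breakerWins_of_pairs {first : Player} (hD : ∀ u ∈ D, IsNode c u)
    (hl : ∀ u ∈ D, u ++ [l u] ∈ D) (hr : ∀ u ∈ D, u ++ [r u] ∈ D) (hlr : ∀ u ∈ D, l u ≠ r u)
    {u₀ : List ℕ} (hu₀ : u₀ ∈ D)
    (hfirst : (u₀ = [] ∧ first = .breaker) ∨ (u₀.length = 1 ∧ first = .maker)) :
    ¬ BreakerWins (familyTree c) [] first := by
  -- The set `f` exempts the edge Breaker has just removed, to which Maker's reply is still due.
  let Answered (f : Set (Sym2 (List ℕ))) (h : History (List ℕ)) : Prop :=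
    (∀ a b, IsPair D l r a b → parentEdge a ∈ removed first h → parentEdge a ∉ f →
      parentEdge b ∈ h ∧ parentEdge b ∉ removed first h) ∧ (u₀ ≠ [] → parentEdge u₀ ∈ h)
  refine not_breakerWins_of_invariant (fun h =>
    (∀ a b, IsPair D l r a b → ¬ (parentEdge a ∈ removed first h ∧ parentEdge b ∈ removed first h)) ∧
    (u₀ ≠ [] → parentEdge u₀ ∉ removed first h) ∧
    (toMove first h = .breaker → Answered ∅ h) ∧
    (toMove first h = .maker → h = [] ∨ ∃ f, Answered {f} h)) ?_ ?_ ?_ ?_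
  · refine ⟨fun a b _ h => h.1, fun _ h => h, fun hb => ⟨fun _ _ _ h => h.elim, fun hne => ?_⟩,
      fun _ => Or.inl rfl⟩
    rcases hfirst with h | h
    · exact absurd h.1 hne
    · rw [h.2] at hb
      cases hb
  · rintro h ⟨h1, h2, -, -⟩
    refine infinite_component_of_pairs hD hl hr hu₀ ?_ h1
    rcases hfirst with ⟨rfl, -⟩ | ⟨hlen, -⟩
    · exact SimpleGraph.Reachable.refl _
    · obtain ⟨i, rfl⟩ := List.length_eq_one_iff.1 hlen
      refine SimpleGraph.Adj.reachable ?_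
      rw [SimpleGraph.deleteEdges_adj]
      exact ⟨familyTree_adj_append (u := []) (hD _ hu₀), h2 (by simp)⟩
  · rintro h ⟨h1, h2, h3, -⟩ ht e he
    obtain ⟨h4, h5⟩ := h3 ht
    -- Had Breaker removed the partner earlier, Maker would have taken this edge in reply, and it
    -- would not be available.
    have hans : ∀ a b, IsPair D l r a b → parentEdge a = e → parentEdge b ∉ removed first h :=
      fun a b hab hae hb => he.2 (hae ▸ (h4 b a hab.symm hb (by simp)).1)
    refine ⟨?_, ?_, fun ht' => ?_, fun _ => Or.inr ⟨e, ?_, fun hne => List.mem_cons_of_mem _ (h5 hne)⟩⟩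
    · rintro a b hab ⟨⟨-, ha⟩ | ha, ⟨-, hb⟩ | hb⟩
      · exact hab.ne hlr (parentEdge_inj hab.ne_nil hab.symm.ne_nil (ha.trans hb.symm))
      · exact hans a b hab ha hb
      · exact hans b a hab.symm hb ha
      · exact h1 a b hab ⟨ha, hb⟩
    · rintro hne (⟨-, h⟩ | h)
      · exact he.2 (h ▸ h5 hne)
      · exact h2 hne h
    · rw [toMove_cons_of_breaker ht] at ht'
      cases ht'
    · rintro a b hab (⟨-, ha⟩ | ha) hae
      · exact absurd ha hae
      · obtain ⟨h6, h7⟩ := h4 a b hab ha (by simp)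
        refine ⟨List.mem_cons_of_mem _ h6, ?_⟩
        rintro (⟨-, h⟩ | h)
        · exact he.2 (h ▸ h6)
        · exact h7 h
  · rintro h ⟨h1, h2, -, h3⟩ ht ⟨e₀, he₀⟩
    have hrem : ∀ e, removed first (e :: h) = removed first h := by
      intro e
      ext x
      simp [mem_removed_cons, ht]
    suffices H : ∃ e ∈ available (familyTree c) h, Answered ∅ (e :: h) by
      obtain ⟨e, he, hA⟩ := H
      refine ⟨e, he, ?_, ?_, fun _ => hA, fun ht' => ?_⟩
      · rwa [hrem]
      · rwa [hrem]
      · rw [toMove_cons_of_maker ht] at ht'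
        cases ht'
    have havail : ∀ w ∈ D, w ≠ [] → parentEdge w ∉ h → parentEdge w ∈ available (familyTree c) h :=
      fun w hw hne hwh => mem_available_iff.2 ⟨w, ⟨hne, hD w hw, hwh⟩, rfl⟩
    rcases h3 ht with rfl | ⟨f, h4, h5⟩
    · rcases hfirst with ⟨-, rfl⟩ | ⟨hlen, -⟩
      · cases ht
      · have hne : u₀ ≠ [] := by rintro rfl; simp at hlen
        refine ⟨_, havail u₀ hu₀ hne (by simp), fun a b _ ha => ?_, fun _ => List.mem_cons_self⟩
        rw [hrem] at ha
        exact ha.elim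
    · by_cases hex : ∃ a b, IsPair D l r a b ∧ parentEdge a = f ∧ parentEdge a ∈ removed first h ∧
        parentEdge b ∉ h
      · obtain ⟨a, b, hab, haf, ha, hb⟩ := hex
        refine ⟨_, havail b (hab.right_mem hl hr) hab.symm.ne_nil hb, fun a' b' hab' ha' _ => ?_,
          fun hne => List.mem_cons_of_mem _ (h5 hne)⟩
        rw [hrem] at ha' ⊢
        by_cases haf' : parentEdge a' = f
        · obtain rfl := parentEdge_inj hab'.ne_nil hab.ne_nil (haf'.trans haf.symm)
          obtain rfl := hab.eq_right hlr hab'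
          exact ⟨List.mem_cons_self, fun h => h1 _ _ hab ⟨ha, h⟩⟩
        · obtain ⟨h6, h7⟩ := h4 a' b' hab' ha' haf'
          exact ⟨List.mem_cons_of_mem _ h6, h7⟩
      -- No reply is due, and an extra Maker edge does no harm, so any available edge will do.
      · refine ⟨e₀, he₀, fun a b hab ha _ => ?_, fun hne => List.mem_cons_of_mem _ (h5 hne)⟩
        rw [hrem] at ha ⊢
        refine ⟨List.mem_cons_of_mem _ ?_, fun hb => h1 a b hab ⟨ha, hb⟩⟩
        by_cases haf : parentEdge a = f
        · by_contra hb
          exact hex ⟨a, b, hab, haf, ha, hb⟩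
        · exact (h4 a b hab ha haf).1

end Pairing

theorem not_breakerWins_of_forall_not_noBinary {first : Player} {u₀ : List ℕ} (hu₀ : IsNode c u₀)
    (h : ¬ ∃ n, NoBinary c n u₀)
    (hfirst : (u₀ = [] ∧ first = .breaker) ∨ (u₀.length = 1 ∧ first = .maker)) :
    ¬ BreakerWins (familyTree c) [] first := by
  have key : ∀ u, ∃ i j, (IsNode c u ∧ ¬ ∃ n, NoBinary c n u) → i ≠ j ∧
      (IsNode c (u ++ [i]) ∧ ¬ ∃ n, NoBinary c n (u ++ [i])) ∧
      (IsNode c (u ++ [j]) ∧ ¬ ∃ n, NoBinary c n (u ++ [j])) := by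
    intro u
    by_cases hu : IsNode c u ∧ ¬ ∃ n, NoBinary c n u
    · have h1 := hu.2
      rw [exists_noBinary_iff] at h1
      simp only [not_exists, not_forall] at h1
      -- The index `0` is arbitrary; excluding the child `i` found here then yields a second one.
      obtain ⟨i, hi, -, hbi⟩ := h1 0
      obtain ⟨j, hj, hji, hbj⟩ := h1 i
      exact ⟨i, j, fun _ => ⟨Ne.symm hji, ⟨isNode_append_iff.2 ⟨hu.1, hi⟩, not_exists.2 hbi⟩,
        isNode_append_iff.2 ⟨hu.1, hj⟩, not_exists.2 hbj⟩⟩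
    · exact ⟨0, 0, fun h => absurd h hu⟩
  choose l r hlr using key
  exact not_breakerWins_of_pairs (D := {u | IsNode c u ∧ ¬ ∃ n, NoBinary c n u})
    (fun u hu => hu.1) (fun u hu => (hlr u hu).2.1) (fun u hu => (hlr u hu).2.2)
    (fun u hu => (hlr u hu).1) ⟨hu₀, h⟩ hfirst

theorem breakerWins_breaker_iff :
    BreakerWins (familyTree c) [] .breaker ↔ ∃ n, NoBinary c n [] := by
  constructor
  · contrapose
    exact fun h => not_breakerWins_of_forall_not_noBinary .root h (Or.inl ⟨rfl, rfl⟩)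
  · rintro ⟨n, hn⟩
    exact breakerWins_breaker_of_noBinary hn

theorem breakerWins_maker_iff :
    BreakerWins (familyTree c) [] .maker ↔ ∀ i < c [], ∃ n, NoBinary c n [i] := by
  refine ⟨fun h i hi => ?_, breakerWins_maker_of_noBinary⟩
  by_contra hn
  exact not_breakerWins_of_forall_not_noBinary
    (isNode_append_iff (u := []).2 ⟨.root, hi⟩) hn (Or.inr ⟨rfl, rfl⟩) h

end GaltonWatson

/-! ### Measurability, independence of subtrees and the recursion -/

namespace GaltonWatson

open MakerBreaker

variable {Ω : Type*} {ν : PMF ℕ} {ξ : List ℕ → Ω → ℕ}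

/-- The σ-algebra generated by the offspring numbers of the individuals in `S`. -/
abbrev offspringAlgebra (ξ : List ℕ → Ω → ℕ) (S : Set (List ℕ)) : MeasurableSpace Ω :=
  ⨆ w ∈ S, MeasurableSpace.comap (ξ w) inferInstance

theorem offspringAlgebra_mono {S T : Set (List ℕ)} (h : S ⊆ T) :
    offspringAlgebra ξ S ≤ offspringAlgebra ξ T := biSup_mono h

theorem measurableSet_offspring {S : Set (List ℕ)} {u : List ℕ} (hu : u ∈ S) (t : Set ℕ) :
    MeasurableSet[offspringAlgebra ξ S] (ξ u ⁻¹' t) :=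
  le_iSup₂ (f := fun w (_ : w ∈ S) => MeasurableSpace.comap (ξ w) inferInstance) u hu _
    ⟨t, MeasurableSet.of_discrete, rfl⟩

theorem measurableSet_noBinary (n : ℕ) (u : List ℕ) :
    MeasurableSet[offspringAlgebra ξ {w | u <+: w}] {ω | NoBinary (fun v => ξ v ω) n u} := by
  induction n generalizing u with
  | zero => exact @MeasurableSet.empty _ (offspringAlgebra ξ {w | u <+: w})
  | succ n ih =>
    have heq : {ω | NoBinary (fun v => ξ v ω) (n + 1) u} =
        ⋃ j, ⋂ i, ((ξ u ⁻¹' Set.Iic i ∪ {_ω | i = j}) ∪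
          {ω | NoBinary (fun v => ξ v ω) n (u ++ [i])}) := by
      ext ω
      simp only [NoBinary, Set.mem_ofPred_eq, Set.mem_iUnion, Set.mem_iInter, Set.mem_union,
        Set.mem_preimage, Set.mem_Iic]
      refine exists_congr fun j => forall_congr' fun i => ?_
      rw [← not_lt]
      tauto
    rw [heq]
    refine MeasurableSet.iUnion fun j => MeasurableSet.iInter fun i => ?_
    refine .union (.union (measurableSet_offspring List.prefix_rfl _) (.const _)) ?_
    exact offspringAlgebra_mono (fun w hw => (List.prefix_append _ _).trans hw) _ (ih _)

theorem measurableSet_exists_noBinary (u : List ℕ) :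
    MeasurableSet[offspringAlgebra ξ {w | u <+: w}] {ω | ∃ n, NoBinary (fun v => ξ v ω) n u} := by
  have heq : {ω | ∃ n, NoBinary (fun w => ξ w ω) n u} =
      ⋃ n, {ω | NoBinary (fun w => ξ w ω) n u} := by ext; simp
  rw [heq]
  exact MeasurableSet.iUnion fun n => measurableSet_noBinary n u

variable [MeasurableSpace Ω] {P : Measure Ω}

namespace IsOffspringFamily

theorem offspringAlgebra_le (hξ : IsOffspringFamily P ν ξ) (S : Set (List ℕ)) :
    offspringAlgebra ξ S ≤ (inferInstance : MeasurableSpace Ω) :=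
  iSup₂_le fun w _ => (hξ.measurable w).comap_le

theorem measureReal_eq (hξ : IsOffspringFamily P ν ξ) (u : List ℕ) (k : ℕ) :
    P.real (ξ u ⁻¹' {k}) = (ν k).toReal := by
  rw [Measure.real, ← Measure.map_apply (hξ.measurable u) (measurableSet_singleton k), hξ.law u,
    PMF.toMeasure_apply_singleton _ _ (measurableSet_singleton k)]

theorem measureReal_inter (hξ : IsOffspringFamily P ν ξ) {S T : Set (List ℕ)} (hST : Disjoint S T)
    {A B : Set Ω} (hA : MeasurableSet[offspringAlgebra ξ S] A)
    (hB : MeasurableSet[offspringAlgebra ξ T] B) : P.real (A ∩ B) = P.real A * P.real B := by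
  have h := indep_iSup_of_disjoint (fun w => (hξ.measurable w).comap_le) hξ.indep.iIndep hST
  simp only [Measure.real, (Indep_iff _ _ _).1 h A B hA hB, ENNReal.toReal_mul]

/-- The vertex `u` and the subtrees at its distinct children form disjoint sets of words, so
independence can be applied one child at a time. -/
theorem measureReal_inter_biInter (hξ : IsOffspringFamily P ν ξ) {u : List ℕ} {E : Set Ω}
    (hE : MeasurableSet[offspringAlgebra ξ {u}] E) {C : ℕ → Set Ω}
    (hC : ∀ i, MeasurableSet[offspringAlgebra ξ {w | u ++ [i] <+: w}] (C i)) (s : Finset ℕ) :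
    P.real (E ∩ ⋂ i ∈ s, C i) = P.real E * ∏ i ∈ s, P.real (C i) := by
  induction s using Finset.induction_on with
  | empty => simp
  | insert a s ha ih =>
    rw [Finset.prod_insert ha, Finset.set_biInter_insert, mul_left_comm, ← ih, mul_comm,
      Set.inter_comm (C a), ← Set.inter_assoc]
    refine hξ.measureReal_inter (S := {u} ∪ ⋃ i ∈ s, {w | u ++ [i] <+: w}) ?_ ?_ (hC a)
    · rw [Set.disjoint_left]
      rintro w hw hwa
      rcases hw with rfl | hw
      · simpa using List.IsPrefix.length_le hwa
      · simp only [Set.mem_iUnion] at hw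
        obtain ⟨i, hi, hwi⟩ := hw
        have := List.prefix_of_prefix_length_le hwi hwa (by simp)
        have := this.eq_of_length (by simp)
        simp only [List.append_cancel_left_eq, List.cons.injEq, and_true] at this
        exact ha (this ▸ hi)
    · refine .inter (offspringAlgebra_mono Set.subset_union_left _ hE) ?_
      refine Finset.measurableSet_biInter _ fun i hi => ?_
      exact offspringAlgebra_mono (Set.subset_union_of_subset_right
        (Set.subset_biUnion_of_mem (u := fun i => {w | u ++ [i] <+: w}) hi) _) _ (hC i)

theorem measureReal_inter_all (hξ : IsOffspringFamily P ν ξ) {u : List ℕ} {B : ℕ → Set Ω} {q : ℝ}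
    (hB : ∀ i, MeasurableSet[offspringAlgebra ξ {w | u ++ [i] <+: w}] (B i))
    (hq : ∀ i, P.real (B i) = q) (k : ℕ) :
    P.real (ξ u ⁻¹' {k} ∩ ⋂ i ∈ Finset.range k, B i) = (ν k).toReal * q ^ k := by
  rw [hξ.measureReal_inter_biInter (measurableSet_offspring (Set.mem_singleton u) _) hB, hξ.measureReal_eq]
  simp [hq]

variable [IsProbabilityMeasure P]

theorem measureReal_inter_all_but (hξ : IsOffspringFamily P ν ξ) {u : List ℕ} {B : ℕ → Set Ω}
    {q : ℝ} (hB : ∀ i, MeasurableSet[offspringAlgebra ξ {w | u ++ [i] <+: w}] (B i))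
    (hq : ∀ i, P.real (B i) = q) {k j : ℕ} (hj : j < k) :
    P.real (ξ u ⁻¹' {k} ∩ ⋂ i ∈ Finset.range k, (if i = j then (B i)ᶜ else B i)) =
      (ν k).toReal * ((1 - q) * q ^ (k - 1)) := by
  rw [hξ.measureReal_inter_biInter (measurableSet_offspring (Set.mem_singleton u) _), hξ.measureReal_eq]
  · congr 1
    rw [← Finset.mul_prod_erase _ _ (Finset.mem_range.2 hj), if_pos rfl,
      probReal_compl_eq_one_sub (hξ.offspringAlgebra_le _ _ (hB j)), hq]
    congr 1
    rw [Finset.prod_congr rfl (g := fun _ => q)]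
    · simp [Finset.card_erase_of_mem (Finset.mem_range.2 hj)]
    · intro i hi
      rw [if_neg (Finset.ne_of_mem_erase hi), hq]
  · intro i
    split_ifs
    exacts [(hB i).compl, hB i]

theorem measureReal_eq_tsum (hξ : IsOffspringFamily P ν ξ) (u : List ℕ) {E : Set Ω}
    (hE : MeasurableSet E) : P.real E = ∑' k, P.real (ξ u ⁻¹' {k} ∩ E) := by
  have hU : E = ⋃ k, ξ u ⁻¹' {k} ∩ E := by ext ω; simp
  conv_lhs => rw [hU]
  rw [Measure.real, measure_iUnion, ENNReal.tsum_toReal_eq fun _ => measure_ne_top _ _]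
  · rfl
  · intro k l hkl
    refine Set.disjoint_left.2 fun ω hω hω' => hkl ?_
    exact hω.1.symm.trans hω'.1
  · exact fun k => ((hξ.measurable u) (measurableSet_singleton k)).inter hE

theorem measureReal_forall_lt (hξ : IsOffspringFamily P ν ξ) {u : List ℕ} {B : ℕ → Set Ω} {q : ℝ}
    (hB : ∀ i, MeasurableSet[offspringAlgebra ξ {w | u ++ [i] <+: w}] (B i))
    (hq : ∀ i, P.real (B i) = q) (hm : MeasurableSet {ω | ∀ i < ξ u ω, ω ∈ B i}) :
    P.real {ω | ∀ i < ξ u ω, ω ∈ B i} = pgf ν q := by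
  rw [hξ.measureReal_eq_tsum u hm, pgf]
  refine tsum_congr fun k => ?_
  rw [← hξ.measureReal_inter_all hB hq]
  congr 1
  ext ω
  simp +contextual

/-- Given `k` children, either all lie in `B` or exactly one fails. Splitting by the failing child
makes the cases disjoint, with `k` equally likely choices. -/
theorem measureReal_exists_forall_ne (hξ : IsOffspringFamily P ν ξ) {u : List ℕ} {B : ℕ → Set Ω}
    {q : ℝ} (hB : ∀ i, MeasurableSet[offspringAlgebra ξ {w | u ++ [i] <+: w}] (B i))
    (hq : ∀ i, P.real (B i) = q)
    (hm : MeasurableSet {ω | ∃ j, ∀ i < ξ u ω, i ≠ j → ω ∈ B i}) :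
    P.real {ω | ∃ j, ∀ i < ξ u ω, i ≠ j → ω ∈ B i} =
      ∑' k : ℕ, (ν k).toReal * (q ^ k + k * ((1 - q) * q ^ (k - 1))) := by
  rw [hξ.measureReal_eq_tsum u hm]
  refine tsum_congr fun k => ?_
  have hBm : ∀ i, MeasurableSet (B i) := fun i => hξ.offspringAlgebra_le _ _ (hB i)
  have hξm : MeasurableSet (ξ u ⁻¹' {k}) := hξ.measurable u (measurableSet_singleton k)
  let C : ℕ → Set Ω := fun j =>
    ξ u ⁻¹' {k} ∩ ⋂ i ∈ Finset.range k, (if i = j then (B i)ᶜ else B i)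
  have hCm : ∀ j, MeasurableSet (C j) := fun j => hξm.inter <|
    Finset.measurableSet_biInter _ fun i _ => by
      split_ifs
      exacts [(hBm i).compl, hBm i]
  have hC : ∀ j ω, ω ∈ C j ↔ ξ u ω = k ∧ ∀ i < k, (i = j → ω ∉ B i) ∧ (i ≠ j → ω ∈ B i) := by
    intro j ω
    simp only [C, Set.mem_inter_iff, Set.mem_preimage, Set.mem_singleton_iff, Set.mem_iInter,
      Finset.mem_range]
    refine and_congr_right fun _ => forall₂_congr fun i _ => ?_
    by_cases hij : i = j <;> simp [hij]
  have hU : ξ u ⁻¹' {k} ∩ {ω | ∃ j, ∀ i < ξ u ω, i ≠ j → ω ∈ B i} =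
      (ξ u ⁻¹' {k} ∩ ⋂ i ∈ Finset.range k, B i) ∪ ⋃ j ∈ Finset.range k, C j := by
    ext ω
    simp only [Set.mem_inter_iff, Set.mem_preimage, Set.mem_singleton_iff, Set.mem_ofPred_eq,
      Set.mem_union, Set.mem_iInter, Finset.mem_range, Set.mem_iUnion, hC, exists_prop]
    constructor
    · rintro ⟨rfl, j, hj⟩
      by_cases hjB : j < ξ u ω ∧ ω ∉ B j
      · exact Or.inr ⟨j, hjB.1, rfl, fun i hi => ⟨fun h => h ▸ hjB.2, hj i hi⟩⟩
      · refine Or.inl ⟨rfl, fun i hi => ?_⟩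
        by_cases hij : i = j
        · subst hij
          by_contra h
          exact hjB ⟨hi, h⟩
        · exact hj i hi hij
    · rintro (⟨rfl, h⟩ | ⟨j, hj, rfl, h⟩)
      -- With no failing child, the exceptional index is arbitrary.
      · exact ⟨rfl, 0, fun i hi _ => h i hi⟩
      · exact ⟨rfl, j, fun i hi => (h i hi).2⟩
  rw [hU, measureReal_union (h₁ := measure_ne_top _ _) (h₂ := measure_ne_top _ _),
    measureReal_biUnion_finset, hξ.measureReal_inter_all hB hq,
    Finset.sum_congr rfl fun j hj =>
      hξ.measureReal_inter_all_but hB hq (Finset.mem_range.1 hj)]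
  · simp only [Finset.sum_const, Finset.card_range, nsmul_eq_mul]
    ring
  · intro j hj j' hj' hne
    refine Set.disjoint_left.2 fun ω hω hω' => ?_
    have hjk : j < k := by simpa using hj
    exact (((hC j ω).1 hω).2 j hjk).1 rfl ((((hC j' ω).1 hω').2 j hjk).2 hne)
  · exact fun j _ => hCm j
  · refine Set.disjoint_left.2 fun ω hω hω' => ?_
    simp only [Set.mem_iUnion, Finset.mem_range, exists_prop] at hω'
    obtain ⟨j, hj, hω'⟩ := hω'
    refine (((hC j ω).1 hω').2 j hj).1 rfl ?_
    have := hω.2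
    simp only [Set.mem_iInter, Finset.mem_range] at this
    exact this j hj
  · exact Finset.measurableSet_biUnion _ fun j _ => hCm j

/-- The recursion expresses the probability at depth `n + 1` through `ν` and the common value at
depth `n`, with no reference to the vertex. -/
theorem measureReal_noBinary_eq (hξ : IsOffspringFamily P ν ξ) (n : ℕ) (u v : List ℕ) :
    P.real {ω | NoBinary (fun w => ξ w ω) n u} = P.real {ω | NoBinary (fun w => ξ w ω) n v} := by
  induction n generalizing u v with
  | zero => simp [NoBinary]
  | succ n ih =>
    have key : ∀ u, P.real {ω | NoBinary (fun w => ξ w ω) (n + 1) u} = _ := fun u =>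
      hξ.measureReal_exists_forall_ne (u := u)
        (B := fun i => {ω | NoBinary (fun w => ξ w ω) n (u ++ [i])})
        (fun i => measurableSet_noBinary n _) (fun i => ih _ [])
        (hξ.offspringAlgebra_le _ _ (measurableSet_noBinary (n + 1) u))
    rw [key u, key v]

theorem measureReal_exists_noBinary_eq (hξ : IsOffspringFamily P ν ξ) (u v : List ℕ) :
    P.real {ω | ∃ n, NoBinary (fun w => ξ w ω) n u} =
      P.real {ω | ∃ n, NoBinary (fun w => ξ w ω) n v} := by
  have key : ∀ u, Filter.Tendsto (fun n => P.real {ω | NoBinary (fun w => ξ w ω) n u}) Filter.atTop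
      (nhds (P.real {ω | ∃ n, NoBinary (fun w => ξ w ω) n u})) := by
    intro u
    have h := tendsto_measure_iUnion_atTop (μ := P)
      (s := fun n => {ω | NoBinary (fun w => ξ w ω) n u}) fun n m hnm ω hω => NoBinary.mono hω hnm
    have heq : {ω | ∃ n, NoBinary (fun w => ξ w ω) n u} =
      ⋃ n, {ω | NoBinary (fun w => ξ w ω) n u} := by ext; simp
    rw [heq]
    exact (ENNReal.tendsto_toReal (measure_ne_top _ _)).comp h
  refine tendsto_nhds_unique (key u) ?_
  simp only [hξ.measureReal_noBinary_eq _ u v]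
  exact key v

end IsOffspringFamily

/-! ### The generating function and its derivative -/

theorem summable_pmf_mul {f : ℕ → ℝ} {C : ℝ} (hf : ∀ k, |f k| ≤ C) :
    Summable fun k => (ν k).toReal * f k := by
  have hν : Summable fun k => (ν k).toReal := ENNReal.summable_toReal ν.tsum_coe_ne_top
  refine .of_norm_bounded (hν.mul_right C) fun k => ?_
  rw [Real.norm_eq_abs, abs_mul, abs_of_nonneg ENNReal.toReal_nonneg]
  exact mul_le_mul_of_nonneg_left (hf k) ENNReal.toReal_nonneg

theorem pgf_one : pgf ν 1 = 1 := by
  have := ENNReal.tsum_toReal_eq (f := ν) fun k => ν.apply_ne_top k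
  rw [ν.tsum_coe] at this
  simpa [pgf] using this.symm

theorem pmf_toReal_le_one (k : ℕ) : (ν k).toReal ≤ 1 :=
  ENNReal.toReal_le_of_le_ofReal zero_le_one (by simpa using ν.coe_le_one k)

theorem summable_deriv_pgf {x : ℝ} (h0 : 0 ≤ x) (h1 : x < 1) :
    Summable fun k : ℕ => (k : ℝ) * x ^ (k - 1) := by
  refine (summable_nat_add_iff 1).1 ?_
  have hx : ‖x‖ < 1 := by rwa [Real.norm_eq_abs, abs_of_nonneg h0]
  have h := (summable_pow_mul_geometric_of_norm_lt_one 1 hx).add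
    (summable_pow_mul_geometric_of_norm_lt_one 0 hx)
  refine h.congr fun k => ?_
  push_cast
  simp only [pow_one, pow_zero]
  ring

theorem hasDerivAt_pgf {x : ℝ} (h0 : 0 ≤ x) (h1 : x < 1) :
    HasDerivAt (pgf ν) (∑' k : ℕ, (ν k).toReal * (k * x ^ (k - 1))) x := by
  -- On the ball of radius `r < 1` the differentiated terms are dominated by the summable `k * r ^
  -- (k - 1)`.
  obtain ⟨r, hxr, hr⟩ := exists_between h1
  have hr0 : 0 ≤ r := h0.trans hxr.le
  have hx : x ∈ Metric.ball (0 : ℝ) r := by simpa [abs_of_nonneg h0] using hxr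
  refine hasDerivAt_tsum_of_isPreconnected (t := Metric.ball (0 : ℝ) r) (y₀ := x)
    (summable_deriv_pgf hr0 hr) Metric.isOpen_ball
    (convex_ball _ _).isPreconnected (fun k y _ => (hasDerivAt_pow k y).const_mul _) ?_ hx ?_ hx
  · intro k y hy
    have hy' : |y| ≤ r := by simpa using (Metric.mem_ball.1 hy).le
    rw [norm_mul, norm_mul, norm_pow, Real.norm_eq_abs, Real.norm_eq_abs, Real.norm_eq_abs,
      abs_of_nonneg ENNReal.toReal_nonneg, Nat.abs_cast]
    calc (ν k).toReal * (k * |y| ^ (k - 1)) ≤ 1 * (k * r ^ (k - 1)) := by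
          gcongr
          exact pmf_toReal_le_one k
      _ = _ := one_mul _
  · exact summable_pmf_mul (C := 1) fun k => by
      rw [abs_pow]
      exact pow_le_one₀ (abs_nonneg _) (by rw [abs_of_nonneg h0]; exact h1.le)

end GaltonWatson

open MakerBreaker GaltonWatson in
theorem theorem4p3 {Ω : Type*} [MeasurableSpace Ω] (P : Measure Ω) [IsProbabilityMeasure P]
    (ν : PMF ℕ) (ξ : List ℕ → Ω → ℕ) (hξ : IsOffspringFamily P ν ξ)
    (p pbar : ℝ)
    (hp : p = P.real (breakerWinsEvent ξ Player.breaker))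
    (hpbar : pbar = P.real (breakerWinsEvent ξ Player.maker)) :
    MeasurableSet (breakerWinsEvent ξ Player.breaker) ∧
    MeasurableSet (breakerWinsEvent ξ Player.maker) ∧
    (p < 1 → DifferentiableAt ℝ (pgf ν) p) ∧
    p = pgf ν p + (1 - p) * deriv (pgf ν) p ∧
    pbar = pgf ν p := by
  let B : List ℕ → Set Ω := fun u => {ω | ∃ n, NoBinary (fun v => ξ v ω) n u}
  have hBm : ∀ u, MeasurableSet (B u) := fun u =>
    hξ.offspringAlgebra_le _ _ (measurableSet_exists_noBinary u)
  have hbr : breakerWinsEvent ξ Player.breaker = B [] :=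
    Set.ext fun ω => breakerWins_breaker_iff
  have hbr' : B [] = {ω | ∃ j, ∀ i < ξ [] ω, i ≠ j → ω ∈ B ([] ++ [i])} :=
    Set.ext fun ω => exists_noBinary_iff
  have hmk : breakerWinsEvent ξ Player.maker = {ω | ∀ i < ξ [] ω, ω ∈ B ([] ++ [i])} :=
    Set.ext fun ω => breakerWins_maker_iff
  have hmkm : MeasurableSet {ω | ∀ i < ξ [] ω, ω ∈ B ([] ++ [i])} := by
    have heq : {ω | ∀ i < ξ [] ω, ω ∈ B ([] ++ [i])} =
        ⋂ i, ((ξ [] ⁻¹' Set.Iic i) ∪ B ([] ++ [i])) := by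
      ext ω
      simp only [Set.mem_ofPred_eq, Set.mem_iInter, Set.mem_union, Set.mem_preimage, Set.mem_Iic]
      refine forall_congr' fun i => ?_
      rw [← not_lt]
      tauto
    rw [heq]
    exact .iInter fun i => (hξ.measurable [] .of_discrete).union (hBm _)
  have hpB : ∀ u, P.real (B u) = p := fun u => by
    rw [hp, hbr]
    exact hξ.measureReal_exists_noBinary_eq u []
  have h0 : 0 ≤ p := hp ▸ measureReal_nonneg
  have h1 : p ≤ 1 := hp ▸ measureReal_le_one
  have hfix : p = ∑' k : ℕ, (ν k).toReal * (p ^ k + k * ((1 - p) * p ^ (k - 1))) := by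
    rw [← hξ.measureReal_exists_forall_ne (fun i => measurableSet_exists_noBinary ([] ++ [i]))
      (fun i => hpB _) (hbr' ▸ hBm []), ← hpB []]
    exact congrArg P.real hbr'
  refine ⟨hbr ▸ hBm [], hmk ▸ hmkm, fun hlt => (hasDerivAt_pgf h0 hlt).differentiableAt, ?_, ?_⟩
  · rcases h1.eq_or_lt with rfl | hlt
    -- For `p = 1` the factor `1 - p` vanishes, whatever value `deriv` takes.
    · simp [pgf_one]
    · rw [(hasDerivAt_pgf h0 hlt).deriv, ← tsum_mul_left, pgf, ← Summable.tsum_add]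
      · refine hfix.trans (tsum_congr fun k => by ring)
      · exact summable_pmf_mul (C := 1) fun k => by
          rw [abs_pow, abs_of_nonneg h0]
          exact pow_le_one₀ h0 h1
      · refine Summable.mul_left _ (.of_nonneg_of_le (fun k => by positivity) (fun k => ?_)
          (summable_deriv_pgf h0 hlt))
        exact mul_le_of_le_one_left (by positivity) (pmf_toReal_le_one k)
  · rw [hpbar, hmk]
    exact hξ.measureReal_forall_lt (fun i => measurableSet_exists_noBinary ([] ++ [i]))
      (fun i => hpB _) hmkm
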